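/- Let $N\ge 1$ be an integer and let $B_N=\{z\in\mathbb C^N:|z|<1\}$ be the open Euclidean unit ball. Let $LFT(B_N)$ be the set of linear fractional self-maps of $B_N$, i.e. the maps $\varphi:B_N\to B_N$ of the form $$\varphi(z)=\frac{Az+B}{\langle z,C\rangle+D},\qquad A\in\mathbb C^{N\times N},\ B,C\in\mathbb C^N,\ D\in\mathbb C,$$ where $\langle z,C\rangle=\sum_j z_j\overline{C_j}$ and $\langle z,C\rangle+D\ne 0$ for all $z\in B_N$. For a fixed point $z_0\in B_N$ of $\varphi$, the unitary index of $\varphi$ at $z_0$ is $$u(\varphi,z_0)=\dim\bigoplus_{|\lambda|=1}\ker\,(d\varphi_{z_0}-\lambda E)^N,$$ where $d\varphi_{z_0}$ is the complex derivative of $\varphi$ at $z_0$ and $E$ is the identity. **Proposition.** Let $\varphi\in LFT(B_N)$ be elliptic, i.e. $\varphi$ has a fixed point in $B_N$; let $z_0\in B_N$ be any fixed point of $\varphi$, put $u=u(\varphi,z_0)$ and suppose that $u\ge 1$. Then there are a map $\psi\in LFT(B_N)$, a diagonal unitary $u\times u$ matrix $\Lambda$ and an $(N-u)\times(N-u)$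 complex matrix $A_1$ with spectral radius $\rho(A_1)<1$ and spectral norm (operator norm for the Euclidean norm) $\|A_1\|\le 1$ such that $\varphi$ is conjugate to $\psi$, that is, $\psi=\sigma\circ\varphi\circ\sigma^{-1}$ for some biholomorphic map $\sigma$ of $B_N$ onto $B_N$, and $$\psi(z',z'')=(\Lambda z',A_1z'')\qquad\text{for all }(z',z'')\in(\mathbb C^u\times\mathbb C^{N-u})\cap B_N .$$ (If $u=N$, the block $A_1$ is empty.) -/

import Mathlib

open Metric Set

noncomputable section

namespace LFT

/-- `ℂ^n` with its standard Hermitian inner product and Euclidean norm. -/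
abbrev CSpace (n : ℕ) : Type := EuclideanSpace ℂ (Fin n)

/-- The open unit ball of `ℂ^n`. -/
abbrev unitBall (n : ℕ) : Set (CSpace n) := ball 0 1

/-- The linear action of a square complex matrix on `ℂ^n`. Its norm is the spectral norm of the
matrix. -/
abbrev act {n : ℕ} (A : Matrix (Fin n) (Fin n) ℂ) : CSpace n →L[ℂ] CSpace n :=
  Matrix.toEuclideanCLM (n := Fin n) (𝕜 := ℂ) A

/-- `φ ∈ LFT(B_N)`: `φ` maps the unit ball to itself and is given there by
`φ z = (A z + B) / (⟨z, C⟩ + D)`, with a denominator that has no zero in the ball.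
Here `⟨z, C⟩` is linear in `z`, hence it is `inner ℂ C z`.
The values of `φ` outside the ball are irrelevant. -/
def IsLinearFractionalSelfMap {N : ℕ} (φ : CSpace N → CSpace N) : Prop :=
  MapsTo φ (unitBall N) (unitBall N) ∧
    ∃ (A : Matrix (Fin N) (Fin N) ℂ) (B C : CSpace N) (D : ℂ),
      ∀ z ∈ unitBall N, inner ℂ C z + D ≠ 0 ∧
        φ z = (inner ℂ C z + D)⁻¹ • (act A z + B)

/-- The unitary space of `φ` at `z₀`: the sum of the generalized eigenspaces
`ker (dφ_{z₀} - λ E)^N` over all `λ` with `|λ| = 1` (the sum is automatically direct). -/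
def unitarySpace {N : ℕ} (φ : CSpace N → CSpace N) (z₀ : CSpace N) :
    Submodule ℂ (CSpace N) :=
  ⨆ (lam : ℂ) (_ : ‖lam‖ = 1),
    LinearMap.ker
      (((fderiv ℂ φ z₀ : CSpace N →ₗ[ℂ] CSpace N) - lam • LinearMap.id) ^ N)

/-- The unitary index of `φ` at `z₀`. -/
def unitaryIndex {N : ℕ} (φ : CSpace N → CSpace N) (z₀ : CSpace N) : ℕ :=
  Module.finrank ℂ (unitarySpace φ z₀)

theorem unitaryIndex_le {N : ℕ} (φ : CSpace N → CSpace N) (z₀ : CSpace N) :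
    unitaryIndex φ z₀ ≤ N := by
  have h := Submodule.finrank_le (unitarySpace φ z₀)
  rwa [finrank_euclideanSpace_fin] at h

/-- `σ` is a biholomorphic map from `D` onto `U` with inverse `τ`. -/
structure IsBiholomorphism {N : ℕ} (D U : Set (CSpace N)) (σ τ : CSpace N → CSpace N) : Prop where
  mapsTo : MapsTo σ D U
  mapsTo_inv : MapsTo τ U D
  leftInv : ∀ z ∈ D, τ (σ z) = z
  rightInv : ∀ w ∈ U, σ (τ w) = w
  holomorphic : DifferentiableOn ℂ σ D
  holomorphic_inv : DifferentiableOn ℂ τ U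

/-- The self-map `φ` of `D` is conjugate to the self-map `ψ` of `U`:
`ψ = σ ∘ φ ∘ σ⁻¹` on `U` for a biholomorphic map `σ` from `D` onto `U`. -/
def IsConjugate {N : ℕ} (D U : Set (CSpace N)) (φ ψ : CSpace N → CSpace N) : Prop :=
  ∃ σ τ : CSpace N → CSpace N, IsBiholomorphism D U σ τ ∧ ∀ w ∈ U, ψ w = σ (φ (τ w))

/-- The point `(z', z'')` of `ℂ^N = ℂ^u × ℂ^(N-u)`, for `u ≤ N`. -/
def pair {N u : ℕ} (h : u ≤ N) (z' : CSpace u) (z'' : CSpace (N - u)) : CSpace N :=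
  WithLp.toLp 2 fun k : Fin N =>
    Fin.append (fun i => z' i) (fun j => z'' j) (Fin.cast (Nat.add_sub_of_le h).symm k)

end LFT

end

/-!
Conjugating by the involution of the ball that exchanges `0` and the fixed point, one may assume
that `φ` fixes `0`, so that `φ z = A z / (1 + ⟨z, C⟩)`. Rotating `z` to make `⟨z, C⟩` negative,
`|φ| < 1` becomes the Schwarz-type estimate `|A w| + |⟨w, C⟩| ≤ |w|`. In particular `A = dφ₀` is a
contraction; and if `A` has a unimodular eigenvalue, with eigenvector `v`, then `C ⊥ v`, and at
`v + ε C` the left side of the estimate grows to first order in `ε`, the right side only to second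
order, unless `C = 0`. So `φ` is linear.

A unimodular eigenvector of a contraction is an eigenvector of its adjoint, for the conjugate
eigenvalue. Hence the unimodular eigenspaces have no generalized part and are mutually orthogonal,
and the orthogonal complement of their sum is invariant; an orthonormal eigenbasis of the sum,
completed by an orthonormal basis of the complement, gives the block form.
-/

namespace LFT

section SchwarzEstimate

variable {𝕜 E F : Type*} [SeminormedAddCommGroup E] [SeminormedAddCommGroup F]

theorem norm_apply_lt_one_of_one_add_ne_zero [NormedField 𝕜] [NormedSpace 𝕜 E] {ℓ : E →ₗ[𝕜] 𝕜}
    (hℓ : ∀ z ∈ ball (0 : E) 1, 1 + ℓ z ≠ 0) {z : E} (hz : z ∈ ball 0 1) : ‖ℓ z‖ < 1 := by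
  by_contra! hlarge
  have hℓz : ℓ z ≠ 0 := norm_pos_iff.1 (one_pos.trans_le hlarge)
  refine hℓ (-(ℓ z)⁻¹ • z) ?_ ?_
  · rw [mem_ball_zero_iff] at hz ⊢
    rw [norm_smul, norm_neg, norm_inv]
    exact (mul_le_of_le_one_left (norm_nonneg z) (inv_le_one_of_one_le₀ hlarge)).trans_lt hz
  · rw [map_smul, smul_eq_mul, neg_mul, inv_mul_cancel₀ hℓz, add_neg_cancel]

theorem norm_apply_add_norm_apply_le [RCLike 𝕜] [NormedSpace 𝕜 E] [NormedSpace 𝕜 F]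
    {A : E →ₗ[𝕜] F} {ℓ : E →ₗ[𝕜] 𝕜} (hℓ : ∀ z ∈ ball (0 : E) 1, 1 + ℓ z ≠ 0)
    (hA : ∀ z ∈ ball (0 : E) 1, ‖A z‖ ≤ ‖1 + ℓ z‖) (w : E) : ‖A w‖ + ‖ℓ w‖ ≤ ‖w‖ := by
  have on_ball : ∀ z ∈ ball (0 : E) 1, ‖A z‖ + ‖ℓ z‖ ≤ 1 := by
    intro z hz
    -- Rotate `z` so that `ℓ z` becomes the negative number `-‖ℓ z‖`.
    obtain ⟨c, hc, hcz⟩ := RCLike.exists_norm_eq_mul_self (ℓ z)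
    have hrot := hA (-c • z) (by simpa [norm_smul, hc] using hz)
    rw [map_smul, map_smul, norm_smul, norm_neg, hc, one_mul, smul_eq_mul, neg_mul, ← hcz,
      ← sub_eq_add_neg, ← RCLike.ofReal_one, ← RCLike.ofReal_sub, RCLike.norm_ofReal,
      abs_of_pos (sub_pos.2 (norm_apply_lt_one_of_one_add_ne_zero hℓ hz))] at hrot
    linarith
  refine le_of_forall_gt_imp_ge_of_dense fun r hr => ?_
  have hr0 : 0 < r := (norm_nonneg w).trans_lt hr
  have hnorm : ‖(r : 𝕜)⁻¹‖ = r⁻¹ := by rw [norm_inv, RCLike.norm_ofReal, abs_of_pos hr0]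
  have hscaled := on_ball ((r : 𝕜)⁻¹ • w) (by
    rwa [mem_ball_zero_iff, norm_smul, hnorm, inv_mul_lt_iff₀ hr0, mul_one])
  rwa [map_smul, map_smul, norm_smul, norm_smul, hnorm, ← mul_add, inv_mul_le_iff₀ hr0,
    mul_one] at hscaled

end SchwarzEstimate

section UnimodularSpace

variable {𝕜 E : Type*} [NormedField 𝕜] [AddCommGroup E] [Module 𝕜 E]

/-- The span of the eigenvectors of `T` whose eigenvalue has absolute value one. Unlike
`unitarySpace` it uses ordinary eigenspaces; for a contraction this makes no difference. -/
def unimodularSpace (T : Module.End 𝕜 E) : Submodule 𝕜 E :=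
  ⨆ (μ : 𝕜) (_ : ‖μ‖ = 1), T.eigenspace μ

theorem eigenspace_le_unimodularSpace (T : Module.End 𝕜 E) {μ : 𝕜} (hμ : ‖μ‖ = 1) :
    T.eigenspace μ ≤ unimodularSpace T :=
  le_iSup₂_of_le μ hμ le_rfl

theorem apply_mem_unimodularSpace (T : Module.End 𝕜 E) {x : E} (hx : x ∈ unimodularSpace T) :
    T x ∈ unimodularSpace T := by
  have hle : unimodularSpace T ≤ (unimodularSpace T).comap T := iSup₂_le fun μ hμ y hy => by
    rw [Submodule.mem_comap, Module.End.mem_eigenspace_iff.1 hy]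
    exact Submodule.smul_mem _ μ (eigenspace_le_unimodularSpace T hμ hy)
  exact hle hx

theorem unimodularSpace_eq_biSup_hasEigenvalue (T : Module.End 𝕜 E) :
    unimodularSpace T = ⨆ μ ∈ {μ : 𝕜 | T.HasEigenvalue μ ∧ ‖μ‖ = 1}, T.eigenspace μ := by
  refine le_antisymm (iSup₂_le fun μ hμ => ?_)
    (iSup₂_le fun μ hμ => eigenspace_le_unimodularSpace T hμ.2)
  by_cases hT : T.HasEigenvalue μ
  · exact le_biSup T.eigenspace (show μ ∈ {μ : 𝕜 | T.HasEigenvalue μ ∧ ‖μ‖ = 1} from ⟨hT, hμ⟩)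
  · rw [Module.End.hasEigenvalue_iff, not_not] at hT
    exact hT ▸ bot_le

theorem exists_hasEigenvalue_of_unimodularSpace_ne_bot {T : Module.End 𝕜 E}
    (hT : unimodularSpace T ≠ ⊥) : ∃ μ : 𝕜, ‖μ‖ = 1 ∧ T.HasEigenvalue μ := by
  contrapose! hT
  simp only [unimodularSpace, iSup_eq_bot]
  exact fun μ hμ => not_not.1 (hT μ hμ)

end UnimodularSpace

section Contraction

variable {𝕜 E : Type*} [RCLike 𝕜] [NormedAddCommGroup E] [InnerProductSpace 𝕜 E]

theorem mem_orthogonal_unimodularSpace_iff {T : Module.End 𝕜 E} {x : E} :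
    x ∈ (unimodularSpace T)ᗮ ↔ ∀ μ : 𝕜, ‖μ‖ = 1 → x ∈ (T.eigenspace μ)ᗮ := by
  rw [unimodularSpace, iSup_subtype', ← Submodule.iInf_orthogonal, Submodule.mem_iInf,
    Subtype.forall]

variable {A : E →L[𝕜] E} {μ : 𝕜} {x : E}

theorem norm_lt_one_of_mem_orthogonal_unimodularSpace (hA : ‖A‖ ≤ 1) (hx₀ : x ≠ 0)
    (hx : A x = μ • x) (hxV : x ∈ (unimodularSpace (A : E →ₗ[𝕜] E))ᗮ) : ‖μ‖ < 1 := by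
  have hle : ‖μ‖ * ‖x‖ ≤ 1 * ‖x‖ := by
    rw [← norm_smul, ← hx]
    exact A.le_of_opNorm_le hA x
  refine lt_of_le_of_ne (le_of_mul_le_mul_right hle (norm_pos_iff.2 hx₀)) fun hμ => hx₀ ?_
  have hmem : x ∈ unimodularSpace (A : E →ₗ[𝕜] E) :=
    eigenspace_le_unimodularSpace _ hμ (Module.End.mem_eigenspace_iff.2 hx)
  exact (Submodule.mem_bot 𝕜).1 ((Submodule.inf_orthogonal_eq_bot _).le ⟨hmem, hxV⟩)

variable [CompleteSpace E]

theorem adjoint_apply_eq_conj_smul (hA : ‖A‖ ≤ 1) (hμ : ‖μ‖ = 1) (hx : A x = μ • x) :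
    A.adjoint x = starRingEnd 𝕜 μ • x := by
  refine eq_of_norm_le_re_inner_eq_norm_sq (𝕜 := 𝕜) ?_ ?_
  · rw [norm_smul, RCLike.norm_conj, hμ]
    exact A.adjoint.le_of_opNorm_le ((LinearIsometryEquiv.norm_map _ A).trans_le hA) x
  · rw [ContinuousLinearMap.adjoint_inner_left, map_smul, hx, inner_smul_right, inner_smul_right,
      ← mul_assoc, RCLike.conj_mul, hμ, norm_smul, RCLike.norm_conj, hμ]
    simp

theorem inner_apply_eq_mul_inner (hA : ‖A‖ ≤ 1) (hμ : ‖μ‖ = 1) (hx : A x = μ • x) (y : E) :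
    inner 𝕜 x (A y) = μ * inner 𝕜 x y := by
  rw [← ContinuousLinearMap.adjoint_inner_left, adjoint_apply_eq_conj_smul hA hμ hx,
    inner_smul_left, RCLike.conj_conj]

theorem norm_le_norm_apply_add_of_inner_eq_zero (hA : ‖A‖ ≤ 1) (hμ : ‖μ‖ = 1)
    (hx : A x = μ • x) {y : E} (hxy : inner 𝕜 x y = 0) : ‖x‖ ≤ ‖A (x + y)‖ := by
  rcases (norm_nonneg x).eq_or_lt with h₀ | hpos
  · exact h₀ ▸ norm_nonneg _
  · have hle := norm_inner_le_norm (𝕜 := 𝕜) x (A (x + y))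
    rw [inner_apply_eq_mul_inner hA hμ hx, inner_add_right, hxy, add_zero, norm_mul, hμ, one_mul,
      inner_self_eq_norm_sq_to_K, norm_pow, RCLike.norm_ofReal, abs_norm, sq] at hle
    exact le_of_mul_le_mul_left hle hpos

theorem eq_zero_of_norm_apply_add_norm_inner_le {C : E}
    (h : ∀ w, ‖A w‖ + ‖inner 𝕜 C w‖ ≤ ‖w‖) (hμ : ‖μ‖ = 1)
    (heig : Module.End.HasEigenvalue (A : E →ₗ[𝕜] E) μ) : C = 0 := by
  obtain ⟨v, hv⟩ := heig.exists_hasEigenvector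
  have hAv : A v = μ • v := hv.apply_eq_smul
  have hA : ‖A‖ ≤ 1 := A.opNorm_le_bound zero_le_one fun w => by
    linarith [h w, norm_nonneg (inner 𝕜 C w)]
  have hCv : inner 𝕜 C v = 0 := by
    have hle := h v
    rw [hAv, norm_smul, hμ, one_mul] at hle
    exact norm_le_zero_iff.1 (by linarith)
  -- Test the hypothesis on `w = v + ‖v‖ • C`, for which `‖A w‖` is still at least `‖v‖`.
  have hvC : inner 𝕜 v ((‖v‖ : 𝕜) • C) = 0 := by
    rw [inner_smul_right, inner_eq_zero_symm.1 hCv, mul_zero]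
  set w : E := v + (‖v‖ : 𝕜) • C with hw
  have norm_w : ‖w‖ ^ 2 = ‖v‖ ^ 2 * (1 + ‖C‖ ^ 2) := by
    rw [hw, norm_add_sq (𝕜 := 𝕜), hvC, map_zero, norm_smul, RCLike.norm_ofReal, abs_norm]
    ring
  have norm_inner_w : ‖inner 𝕜 C w‖ = ‖v‖ * ‖C‖ ^ 2 := by
    rw [hw, inner_add_right, hCv, zero_add, inner_smul_right, inner_self_eq_norm_sq_to_K]
    simp
  have lower : ‖v‖ * (1 + ‖C‖ ^ 2) ≤ ‖w‖ := by
    linarith [h w, norm_le_norm_apply_add_of_inner_eq_zero hA hμ hAv hvC]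
  have lower_sq : ‖v‖ ^ 2 * (1 + ‖C‖ ^ 2) ^ 2 ≤ ‖v‖ ^ 2 * (1 + ‖C‖ ^ 2) := by
    rw [← norm_w, ← mul_pow]
    gcongr
  have hv_pos : 0 < ‖v‖ := norm_pos_iff.2 hv.2
  have hC : (1 + ‖C‖ ^ 2) ^ 2 ≤ 1 + ‖C‖ ^ 2 := le_of_mul_le_mul_left lower_sq (by positivity)
  exact norm_eq_zero.1 (pow_eq_zero_iff two_ne_zero |>.1 (by nlinarith [sq_nonneg ‖C‖]))

theorem ker_sub_smul_pow_eq_eigenspace (hA : ‖A‖ ≤ 1) (hμ : ‖μ‖ = 1) {n : ℕ} (hn : n ≠ 0) :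
    LinearMap.ker (((A : E →ₗ[𝕜] E) - μ • LinearMap.id) ^ n) =
      Module.End.eigenspace (A : E →ₗ[𝕜] E) μ := by
  set T : Module.End 𝕜 E := (A : E →ₗ[𝕜] E) - μ • LinearMap.id
  have hker : LinearMap.ker T = Module.End.eigenspace (A : E →ₗ[𝕜] E) μ :=
    Module.End.eigenspace_def.symm
  have hsq : LinearMap.ker (T ^ 1) = LinearMap.ker (T ^ 2) := by
    refine le_antisymm (LinearMap.iterateKer T |>.monotone one_le_two) fun x hx => ?_
    have hTx : A (T x) = μ • T x := by
      rw [pow_two] at hx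
      exact sub_eq_zero.1 hx
    have orthogonal : inner 𝕜 (T x) (T x) = 0 := by
      change inner 𝕜 (T x) (A x - μ • x) = 0
      rw [inner_sub_right, inner_apply_eq_mul_inner hA hμ hTx, inner_smul_right, sub_self]
    rw [pow_one]
    exact inner_self_eq_zero.1 orthogonal
  obtain ⟨m, rfl⟩ := Nat.exists_eq_add_of_le (Nat.one_le_iff_ne_zero.2 hn)
  rw [← hker, ← Module.End.ker_pow_constant hsq m, pow_one]

theorem inner_eq_zero_of_unimodular_of_ne (hA : ‖A‖ ≤ 1) (hμ : ‖μ‖ = 1) (hx : A x = μ • x)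
    {ν : 𝕜} (hμν : μ ≠ ν) {y : E} (hy : A y = ν • y) : inner 𝕜 x y = 0 := by
  have h := inner_apply_eq_mul_inner hA hμ hx y
  rw [hy, inner_smul_right] at h
  exact (mul_eq_mul_right_iff.1 h).resolve_left hμν.symm

theorem apply_mem_orthogonal_unimodularSpace (hA : ‖A‖ ≤ 1)
    (hx : x ∈ (unimodularSpace (A : E →ₗ[𝕜] E))ᗮ) :
    A x ∈ (unimodularSpace (A : E →ₗ[𝕜] E))ᗮ := by
  rw [mem_orthogonal_unimodularSpace_iff] at hx ⊢
  intro μ hμ v hv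
  rw [inner_apply_eq_mul_inner hA hμ (Module.End.mem_eigenspace_iff.1 hv), hx μ hμ v hv, mul_zero]

theorem exists_orthonormalBasis_unimodularSpace [FiniteDimensional 𝕜 E] (hA : ‖A‖ ≤ 1) {n : ℕ}
    (hn : Module.finrank 𝕜 (unimodularSpace (A : E →ₗ[𝕜] E)) = n) :
    ∃ (b : OrthonormalBasis (Fin n) 𝕜 (unimodularSpace (A : E →ₗ[𝕜] E))) (μ : Fin n → 𝕜),
      ∀ i, ‖μ i‖ = 1 ∧ A (b i) = μ i • (b i : E) := by
  classical
  set T : Module.End 𝕜 E := (A : E →ₗ[𝕜] E)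
  let s : Set 𝕜 := {μ | T.HasEigenvalue μ ∧ ‖μ‖ = 1}
  have : Fintype s := (T.finite_hasEigenvalue.subset fun μ hμ => hμ.1).fintype
  rw [unimodularSpace_eq_biSup_hasEigenvalue] at hn ⊢
  have internal := DirectSum.isInternal_biSup_submodule_of_iSupIndep (A := T.eigenspace) s
    (T.eigenspaces_iSupIndep.comp Subtype.val_injective)
  have orthogonal : OrthogonalFamily 𝕜
      (fun μ : s => (T.eigenspace μ).comap (⨆ μ ∈ s, T.eigenspace μ).subtype)
      fun μ => ((T.eigenspace μ).comap (⨆ μ ∈ s, T.eigenspace μ).subtype).subtypeₗᵢ :=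
    fun μ ν hμν x y => inner_eq_zero_of_unimodular_of_ne hA μ.2.2
      (Module.End.mem_eigenspace_iff.1 x.2) (Subtype.coe_injective.ne hμν)
      (Module.End.mem_eigenspace_iff.1 y.2)
  refine ⟨internal.subordinateOrthonormalBasis hn orthogonal,
    fun i => (internal.subordinateOrthonormalBasisIndex hn i orthogonal : s), fun i => ⟨?_, ?_⟩⟩
  · exact (internal.subordinateOrthonormalBasisIndex hn i orthogonal : s).2.2
  · exact Module.End.mem_eigenspace_iff.1
      (internal.subordinateOrthonormalBasis_subordinate hn i orthogonal)

end Contraction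

section BlockForm

theorem spectralRadius_lt_of_finite_spectrum {𝕜 R : Type*} [NormedField 𝕜] [Ring R] [Algebra 𝕜 R]
    {a : R} (hfin : (spectrum 𝕜 a).Finite) {r : ENNReal} (hr : 0 < r)
    (h : ∀ μ ∈ spectrum 𝕜 a, (‖μ‖₊ : ENNReal) < r) : spectralRadius 𝕜 a < r := by
  have hsup : spectralRadius 𝕜 a = hfin.toFinset.sup fun μ => (‖μ‖₊ : ENNReal) := by
    simp [spectralRadius, Finset.sup_eq_iSup]
  rw [hsup, Finset.sup_lt_iff hr]
  exact fun μ hμ => h μ (hfin.mem_toFinset.1 hμ)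

section MatrixOfLinearMap

variable {𝕜 F ι : Type*} [RCLike 𝕜] [NormedAddCommGroup F] [InnerProductSpace 𝕜 F]
  [FiniteDimensional 𝕜 F] [Fintype ι] [DecidableEq ι] (c : OrthonormalBasis ι 𝕜 F) {T : F →ₗ[𝕜] F}

theorem spectralRadius_toMatrixOrthonormal_lt_one
    (hT : ∀ μ, Module.End.HasEigenvalue T μ → ‖μ‖ < 1) :
    spectralRadius 𝕜 (LinearMap.toMatrixOrthonormal c T) < 1 := by
  refine spectralRadius_lt_of_finite_spectrum (Matrix.finite_spectrum _) one_pos fun μ hμ => ?_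
  rw [AlgEquiv.spectrum_eq, ← Module.End.hasEigenvalue_iff_mem_spectrum] at hμ
  exact_mod_cast hT μ hμ

theorem toEuclideanCLM_toMatrixOrthonormal_repr (x : F) :
    Matrix.toEuclideanCLM (n := ι) (𝕜 := 𝕜) (LinearMap.toMatrixOrthonormal c T) (c.repr x) =
      c.repr (T x) := by
  ext i
  exact congrFun (LinearMap.toMatrix_mulVec_repr c.toBasis c.toBasis T x) i

theorem norm_toEuclideanCLM_toMatrixOrthonormal_le_one (hT : ∀ x, ‖T x‖ ≤ ‖x‖) :
    ‖Matrix.toEuclideanCLM (n := ι) (𝕜 := 𝕜) (LinearMap.toMatrixOrthonormal c T)‖ ≤ 1 := by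
  refine ContinuousLinearMap.opNorm_le_bound _ zero_le_one fun z => ?_
  obtain ⟨x, rfl⟩ := c.repr.surjective z
  rw [toEuclideanCLM_toMatrixOrthonormal_repr, c.repr.norm_map, c.repr.norm_map, one_mul]
  exact hT x

theorem toMatrixOrthonormal_eq_diagonal {μ : ι → 𝕜} (hT : ∀ i, T (c i) = μ i • c i) :
    LinearMap.toMatrixOrthonormal c T = Matrix.diagonal μ := by
  ext i j
  rw [LinearMap.toMatrixOrthonormal_apply_apply, hT, inner_smul_right,
    orthonormal_iff_ite.1 c.orthonormal, Matrix.diagonal_apply]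
  obtain rfl | hij := eq_or_ne i j
  · simp
  · simp [hij]

end MatrixOfLinearMap

theorem diagonal_mem_unitaryGroup {𝕜 ι : Type*} [RCLike 𝕜] [Fintype ι] [DecidableEq ι] {μ : ι → 𝕜}
    (hμ : ∀ i, ‖μ i‖ = 1) : Matrix.diagonal μ ∈ Matrix.unitaryGroup ι 𝕜 := by
  rw [Matrix.mem_unitaryGroup_iff, Matrix.star_eq_conjTranspose, Matrix.diagonal_conjTranspose,
    Matrix.diagonal_mul_diagonal, ← Matrix.diagonal_one]
  congr 1
  ext i
  simp [RCLike.mul_conj, hμ i]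

variable {E : Type*} [NormedAddCommGroup E] [InnerProductSpace ℂ E] {N u : ℕ}
  {V : Submodule ℂ E} [V.HasOrthogonalProjection]

/-- The orthonormal basis of `E` that lists an orthonormal basis of `V` followed by one of `Vᗮ`,
indexed so that its coordinates split as in `pair`. -/
noncomputable def adaptedBasis (h : u ≤ N) (b : OrthonormalBasis (Fin u) ℂ V)
    (c : OrthonormalBasis (Fin (N - u)) ℂ Vᗮ) : OrthonormalBasis (Fin N) ℂ E :=
  ((b.prod c).map V.orthogonalDecomposition.symm).reindex
    (finSumFinEquiv.trans (finCongr (Nat.add_sub_of_le h)))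

theorem adaptedBasis_repr_add (h : u ≤ N) (b : OrthonormalBasis (Fin u) ℂ V)
    (c : OrthonormalBasis (Fin (N - u)) ℂ Vᗮ) (x : V) (y : Vᗮ) :
    (adaptedBasis h b c).repr (x + y) = pair h (b.repr x) (c.repr y) := by
  ext k
  obtain ⟨k, rfl⟩ := (finCongr (Nat.add_sub_of_le h)).surjective k
  rw [OrthonormalBasis.repr_apply_apply, adaptedBasis, OrthonormalBasis.reindex_apply,
    OrthonormalBasis.map_apply]
  refine Fin.addCases (fun i => ?_) (fun j => ?_) k
  · simp [pair, inner_add_right, OrthonormalBasis.repr_apply_apply,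
      Submodule.inner_right_of_mem_orthogonal (b i).2 y.2]
  · simp [pair, inner_add_right, OrthonormalBasis.repr_apply_apply,
      Submodule.inner_left_of_mem_orthogonal x.2 (c j).2]

theorem exists_isometry_blockForm [FiniteDimensional ℂ E] (h : u ≤ N)
    (hE : Module.finrank ℂ E = N) {A : E →L[ℂ] E} (hA : ‖A‖ ≤ 1)
    (hu : Module.finrank ℂ (unimodularSpace (A : E →ₗ[ℂ] E)) = u) :
    ∃ (U : E ≃ₗᵢ[ℂ] CSpace N) (Λ : Matrix (Fin u) (Fin u) ℂ)
      (A₁ : Matrix (Fin (N - u)) (Fin (N - u)) ℂ),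
      Λ.IsDiag ∧ Λ ∈ Matrix.unitaryGroup (Fin u) ℂ ∧ spectralRadius ℂ A₁ < 1 ∧ ‖act A₁‖ ≤ 1 ∧
      ∀ z' z'', U (A (U.symm (pair h z' z''))) = pair h (act Λ z') (act A₁ z'') := by
  set V := unimodularSpace (A : E →ₗ[ℂ] E)
  obtain ⟨b, μ, hb⟩ := exists_orthonormalBasis_unimodularSpace hA hu
  have finrank_compl : Module.finrank ℂ Vᗮ = N - u := by
    have := V.finrank_add_finrank_orthogonal
    omega
  let c := (stdOrthonormalBasis ℂ Vᗮ).reindex (finCongr finrank_compl)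
  let S : V →ₗ[ℂ] V := (A : E →ₗ[ℂ] E).restrict fun _ => apply_mem_unimodularSpace (A : E →ₗ[ℂ] E)
  let T : Vᗮ →ₗ[ℂ] Vᗮ := (A : E →ₗ[ℂ] E).restrict fun _ => apply_mem_orthogonal_unimodularSpace hA
  have hS : LinearMap.toMatrixOrthonormal b S = Matrix.diagonal μ :=
    toMatrixOrthonormal_eq_diagonal b fun i => Subtype.ext (hb i).2
  have hT : ∀ y, ‖T y‖ ≤ ‖y‖ := fun y => (A.le_of_opNorm_le hA y).trans_eq (one_mul _)
  have hT_eig : ∀ ν, Module.End.HasEigenvalue T ν → ‖ν‖ < 1 := fun ν hν => by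
    obtain ⟨y, hy⟩ := hν.exists_hasEigenvector
    exact norm_lt_one_of_mem_orthogonal_unimodularSpace hA (Submodule.coe_eq_zero.not.2 hy.2)
      (congrArg Subtype.val hy.apply_eq_smul) y.2
  refine ⟨(adaptedBasis h b c).repr, Matrix.diagonal μ, LinearMap.toMatrixOrthonormal c T,
    Matrix.isDiag_diagonal μ, diagonal_mem_unitaryGroup fun i => (hb i).1,
    spectralRadius_toMatrixOrthonormal_lt_one c hT_eig,
    norm_toEuclideanCLM_toMatrixOrthonormal_le_one c hT, fun z' z'' => ?_⟩
  obtain ⟨x, rfl⟩ := b.repr.surjective z'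
  obtain ⟨y, rfl⟩ := c.repr.surjective z''
  rw [← adaptedBasis_repr_add, LinearIsometryEquiv.symm_apply_apply, map_add, ← hS,
    toEuclideanCLM_toMatrixOrthonormal_repr, toEuclideanCLM_toMatrixOrthonormal_repr,
    ← adaptedBasis_repr_add]
  rfl

end BlockForm

section BallInvolution

variable (𝕜 : Type*) {E : Type*} [RCLike 𝕜] [NormedAddCommGroup E]

/-- The scalar `√(1 - ‖a‖²)` by which the numerator of `ballInvolution 𝕜 a` scales the orthogonal
complement of `a`. -/
noncomputable def ballScale (a : E) : 𝕜 := (√(1 - ‖a‖ ^ 2) : ℝ)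

theorem ballScale_ne_zero {a : E} (ha : ‖a‖ < 1) : ballScale 𝕜 a ≠ 0 := by
  have h : 0 < 1 - ‖a‖ ^ 2 := by nlinarith [norm_nonneg a]
  exact RCLike.ofReal_ne_zero.2 (Real.sqrt_pos.2 h).ne'

theorem one_add_ballScale_ne_zero (a : E) : 1 + ballScale 𝕜 a ≠ 0 := by
  rw [ballScale, ← RCLike.ofReal_one, ← RCLike.ofReal_add, RCLike.ofReal_ne_zero]
  positivity

theorem conj_ballScale (a : E) : starRingEnd 𝕜 (ballScale 𝕜 a) = ballScale 𝕜 a :=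
  RCLike.conj_ofReal _

variable [InnerProductSpace 𝕜 E]

/-- The involutive automorphism of the unit ball that exchanges `0` and `a`. With `P` the orthogonal
projection onto the line of `a` and `s = ballScale 𝕜 a`, it is usually written
`z ↦ (a - P z - s • (z - P z)) / (1 - ⟪a, z⟫)`; here `(1 - s) • P z` is replaced by
`(⟪a, z⟫ / (1 + s)) • a`, which makes sense at `a = 0` as well. -/
noncomputable def ballInvolution (a z : E) : E :=
  (1 - inner 𝕜 a z)⁻¹ • ((1 - inner 𝕜 a z / (1 + ballScale 𝕜 a)) • a - ballScale 𝕜 a • z)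

variable {a : E}

theorem ballScale_sq (ha : ‖a‖ < 1) : ballScale 𝕜 a ^ 2 = 1 - inner 𝕜 a a := by
  have h : 0 ≤ 1 - ‖a‖ ^ 2 := by nlinarith [norm_nonneg a]
  rw [ballScale, ← RCLike.ofReal_pow, Real.sq_sqrt h, inner_self_eq_norm_sq_to_K]
  push_cast
  rfl

theorem one_sub_inner_ne_zero {x y : E} (hx : ‖x‖ < 1) (hy : ‖y‖ < 1) : 1 - inner 𝕜 x y ≠ 0 := by
  have hlt : ‖inner 𝕜 x y‖ < 1 :=
    (norm_inner_le_norm x y).trans_lt (mul_lt_one_of_nonneg_of_lt_one_left (norm_nonneg x) hx hy.le)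
  intro h
  rw [← sub_eq_zero.1 h, norm_one] at hlt
  exact lt_irrefl 1 hlt

theorem ballInvolution_zero (a : E) : ballInvolution 𝕜 a 0 = a := by
  simp [ballInvolution]

theorem one_sub_inner_ballInvolution (ha : ‖a‖ < 1) {z w : E} (hz : ‖z‖ < 1) (hw : ‖w‖ < 1) :
    1 - inner 𝕜 (ballInvolution 𝕜 a z) (ballInvolution 𝕜 a w) =
      ballScale 𝕜 a ^ 2 * (1 - inner 𝕜 z w) / ((1 - inner 𝕜 z a) * (1 - inner 𝕜 a w)) := by
  have hza := one_sub_inner_ne_zero 𝕜 hz ha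
  have haw := one_sub_inner_ne_zero 𝕜 ha hw
  have hs := one_add_ballScale_ne_zero 𝕜 a
  have haa : inner 𝕜 a a = 1 - ballScale 𝕜 a ^ 2 := by rw [ballScale_sq 𝕜 ha, sub_sub_cancel]
  simp only [ballInvolution, inner_smul_left, inner_smul_right, inner_sub_left, inner_sub_right,
    map_sub, map_inv₀, map_div₀, map_add, map_one, inner_conj_symm, conj_ballScale, haa]
  field_simp
  ring

theorem one_sub_norm_ballInvolution_sq (ha : ‖a‖ < 1) {z : E} (hz : ‖z‖ < 1) :
    1 - ‖ballInvolution 𝕜 a z‖ ^ 2 =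
      (1 - ‖a‖ ^ 2) * (1 - ‖z‖ ^ 2) / ‖1 - inner 𝕜 a z‖ ^ 2 := by
  have hden : (1 - inner 𝕜 z a) * (1 - inner 𝕜 a z) = (‖1 - inner 𝕜 a z‖ : 𝕜) ^ 2 := by
    rw [← RCLike.conj_mul, map_sub, map_one, inner_conj_symm]
  have h := one_sub_inner_ballInvolution 𝕜 ha hz hz
  rw [hden, ballScale_sq 𝕜 ha] at h
  simp only [inner_self_eq_norm_sq_to_K] at h
  exact_mod_cast h

theorem norm_ballInvolution_lt_one (ha : ‖a‖ < 1) {z : E} (hz : ‖z‖ < 1) :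
    ‖ballInvolution 𝕜 a z‖ < 1 := by
  have hd : 0 < ‖1 - inner 𝕜 a z‖ := norm_pos_iff.2 (one_sub_inner_ne_zero 𝕜 ha hz)
  have hpos : 0 < 1 - ‖ballInvolution 𝕜 a z‖ ^ 2 := by
    rw [one_sub_norm_ballInvolution_sq 𝕜 ha hz]
    have ha₂ : 0 < 1 - ‖a‖ ^ 2 := sub_pos.2 (pow_lt_one₀ (norm_nonneg a) ha two_ne_zero)
    have hz₂ : 0 < 1 - ‖z‖ ^ 2 := sub_pos.2 (pow_lt_one₀ (norm_nonneg z) hz two_ne_zero)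
    positivity
  exact (sq_lt_one_iff₀ (norm_nonneg _)).1 (sub_pos.1 hpos)

theorem ballInvolution_ballInvolution (ha : ‖a‖ < 1) {z : E} (hz : ‖z‖ < 1) :
    ballInvolution 𝕜 a (ballInvolution 𝕜 a z) = z := by
  have hd := one_sub_inner_ne_zero 𝕜 ha hz
  have hs := ballScale_ne_zero 𝕜 ha
  have hs₁ := one_add_ballScale_ne_zero 𝕜 a
  have hden : 1 - inner 𝕜 a (ballInvolution 𝕜 a z) =
      ballScale 𝕜 a ^ 2 / (1 - inner 𝕜 a z) := by
    simpa [ballInvolution_zero] using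
      one_sub_inner_ballInvolution 𝕜 ha (norm_zero.trans_lt one_pos) hz
  have hinner : inner 𝕜 a (ballInvolution 𝕜 a z) =
      1 - ballScale 𝕜 a ^ 2 / (1 - inner 𝕜 a z) := by rw [← hden, sub_sub_cancel]
  rw [ballInvolution, hinner, ballInvolution]
  match_scalars
  · field_simp
    ring
  · field_simp
    ring

theorem ballInvolution_self (ha : ‖a‖ < 1) : ballInvolution 𝕜 a a = 0 := by
  simpa only [ballInvolution_zero] using
    ballInvolution_ballInvolution 𝕜 ha (norm_zero.trans_lt one_pos)

theorem differentiableOn_ballInvolution (ha : ‖a‖ < 1) :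
    DifferentiableOn 𝕜 (ballInvolution 𝕜 a) (ball 0 1) := by
  have hinner : Differentiable 𝕜 fun z : E => inner 𝕜 a z := (innerSL 𝕜 a).differentiable
  have hinv : DifferentiableOn 𝕜 (fun z : E => (1 - inner 𝕜 a z)⁻¹) (ball 0 1) :=
    (hinner.const_sub 1).differentiableOn.inv fun z hz =>
      one_sub_inner_ne_zero 𝕜 ha (mem_ball_zero_iff.1 hz)
  have hnum : Differentiable 𝕜 fun z : E =>
      (1 - inner 𝕜 a z / (1 + ballScale 𝕜 a)) • a - ballScale 𝕜 a • z := by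
    simp only [div_eq_mul_inv]
    exact (((hinner.mul_const _).const_sub 1).smul_const a).sub (differentiable_id.const_smul _)
  exact hinv.smul hnum.differentiableOn

theorem isBiholomorphism_ballInvolution {N : ℕ} {a : CSpace N} (ha : ‖a‖ < 1) :
    IsBiholomorphism (unitBall N) (unitBall N) (ballInvolution ℂ a) (ballInvolution ℂ a) where
  mapsTo _ hz := mem_ball_zero_iff.2 (norm_ballInvolution_lt_one ℂ ha (mem_ball_zero_iff.1 hz))
  mapsTo_inv _ hz := mem_ball_zero_iff.2 (norm_ballInvolution_lt_one ℂ ha (mem_ball_zero_iff.1 hz))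
  leftInv _ hz := ballInvolution_ballInvolution ℂ ha (mem_ball_zero_iff.1 hz)
  rightInv _ hz := ballInvolution_ballInvolution ℂ ha (mem_ball_zero_iff.1 hz)
  holomorphic := differentiableOn_ballInvolution ℂ ha
  holomorphic_inv := differentiableOn_ballInvolution ℂ ha

end BallInvolution

section Projective

variable {𝕜 E F G : Type*} [Field 𝕜] [AddCommGroup E] [Module 𝕜 E] [AddCommGroup F] [Module 𝕜 F]
  [AddCommGroup G] [Module 𝕜 G] {s : Set E} {f : E → F}

variable (𝕜) in
/-- `f` is given on `s` by a linear map in homogeneous coordinates, the point `z` being represented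
by the nonzero multiples of `(z, 1)`. In this form linear fractional maps visibly compose. -/
def IsProjectiveOn (s : Set E) (f : E → F) : Prop :=
  ∃ L : E × 𝕜 →ₗ[𝕜] F × 𝕜, ∀ z ∈ s, ∃ c : 𝕜, c ≠ 0 ∧ L (z, 1) = c • (f z, 1)

theorem IsProjectiveOn.comp {t : Set F} {g : F → G} (hg : IsProjectiveOn 𝕜 t g)
    (hf : IsProjectiveOn 𝕜 s f) (hst : MapsTo f s t) : IsProjectiveOn 𝕜 s (g ∘ f) := by
  obtain ⟨L, hL⟩ := hf
  obtain ⟨M, hM⟩ := hg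
  refine ⟨M ∘ₗ L, fun z hz => ?_⟩
  obtain ⟨c, hc, hLz⟩ := hL z hz
  obtain ⟨d, hd, hMz⟩ := hM (f z) (hst hz)
  refine ⟨c * d, mul_ne_zero hc hd, ?_⟩
  rw [LinearMap.comp_apply, hLz, map_smul, hMz, smul_smul, Function.comp_apply]

theorem isProjectiveOn_iff_exists_linearFractional :
    IsProjectiveOn 𝕜 s f ↔ ∃ (A : E →ₗ[𝕜] F) (B : F) (ℓ : E →ₗ[𝕜] 𝕜) (D : 𝕜),
      ∀ z ∈ s, ℓ z + D ≠ 0 ∧ f z = (ℓ z + D)⁻¹ • (A z + B) := by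
  constructor
  · rintro ⟨L, hL⟩
    let L₀ : E →ₗ[𝕜] F × 𝕜 := L ∘ₗ LinearMap.inl 𝕜 E 𝕜
    refine ⟨LinearMap.fst 𝕜 F 𝕜 ∘ₗ L₀, (L (0, 1)).1, LinearMap.snd 𝕜 F 𝕜 ∘ₗ L₀, (L (0, 1)).2,
      fun z hz => ?_⟩
    obtain ⟨c, hc, hLz⟩ := hL z hz
    have hsplit : L (z, 0) + L (0, 1) = c • (f z, 1) := by rw [← hLz, ← map_add]; simp
    have hden : (L (z, 0)).2 + (L (0, 1)).2 = c := by simpa using congrArg Prod.snd hsplit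
    have hnum : (L (z, 0)).1 + (L (0, 1)).1 = c • f z := congrArg Prod.fst hsplit
    change (L (z, 0)).2 + (L (0, 1)).2 ≠ 0 ∧
      f z = ((L (z, 0)).2 + (L (0, 1)).2)⁻¹ • ((L (z, 0)).1 + (L (0, 1)).1)
    rw [hden, hnum, inv_smul_smul₀ hc]
    exact ⟨hc, rfl⟩
  · rintro ⟨A, B, ℓ, D, h⟩
    refine ⟨(A.coprod (LinearMap.toSpanSingleton 𝕜 F B)).prod
      (ℓ.coprod (LinearMap.toSpanSingleton 𝕜 𝕜 D)), fun z hz => ?_⟩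
    obtain ⟨hden, hf⟩ := h z hz
    exact ⟨ℓ z + D, hden, by simp [hf, hden]⟩

end Projective

section LinearFractional

variable {N : ℕ} {φ χ : CSpace N → CSpace N}

theorem isLinearFractionalSelfMap_iff :
    IsLinearFractionalSelfMap φ ↔
      MapsTo φ (unitBall N) (unitBall N) ∧ IsProjectiveOn ℂ (unitBall N) φ := by
  rw [IsLinearFractionalSelfMap, isProjectiveOn_iff_exists_linearFractional]
  refine and_congr_right fun _ => ⟨?_, ?_⟩
  · rintro ⟨A, B, C, D, h⟩
    exact ⟨(act A : CSpace N →ₗ[ℂ] CSpace N), B, innerₛₗ ℂ C, D, h⟩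
  · rintro ⟨A, B, ℓ, D, h⟩
    obtain ⟨M, hM⟩ := (Matrix.toEuclideanCLM (n := Fin N) (𝕜 := ℂ)).surjective
      (LinearMap.toContinuousLinearMap A)
    obtain ⟨C, hC⟩ := (InnerProductSpace.toDual ℂ (CSpace N)).surjective
      (LinearMap.toContinuousLinearMap ℓ)
    have hAM : ∀ z, act M z = A z := fun z => DFunLike.congr_fun hM z
    have hℓC : ∀ z, inner ℂ C z = ℓ z := fun z => DFunLike.congr_fun hC z
    exact ⟨M, B, C, D, by simpa only [hAM, hℓC] using h⟩

theorem IsLinearFractionalSelfMap.comp (hφ : IsLinearFractionalSelfMap φ)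
    (hχ : IsLinearFractionalSelfMap χ) : IsLinearFractionalSelfMap (φ ∘ χ) := by
  rw [isLinearFractionalSelfMap_iff] at *
  exact ⟨hφ.1.comp hχ.1, hφ.2.comp hχ.2 hχ.1⟩

theorem isLinearFractionalSelfMap_of_norm_apply_le {A : CSpace N →ₗ[ℂ] CSpace N}
    (hA : ∀ z, ‖A z‖ ≤ ‖z‖) : IsLinearFractionalSelfMap A :=
  isLinearFractionalSelfMap_iff.2
    ⟨fun z hz => mem_ball_zero_iff.2 ((hA z).trans_lt (mem_ball_zero_iff.1 hz)),
      isProjectiveOn_iff_exists_linearFractional.2 ⟨A, 0, 0, 1, by simp⟩⟩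

theorem isLinearFractionalSelfMap_ballInvolution {a : CSpace N} (ha : ‖a‖ < 1) :
    IsLinearFractionalSelfMap (ballInvolution ℂ a) := by
  refine isLinearFractionalSelfMap_iff.2 ⟨(isBiholomorphism_ballInvolution ha).mapsTo,
    isProjectiveOn_iff_exists_linearFractional.2
      ⟨-((1 + ballScale ℂ a)⁻¹ • (innerₛₗ ℂ a).smulRight a) - ballScale ℂ a • LinearMap.id, a,
        -innerₛₗ ℂ a, 1, fun z hz => ?_⟩⟩
  have hden : (-innerₛₗ ℂ a) z + 1 = 1 - inner ℂ a z := by simp [sub_eq_neg_add]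
  rw [hden]
  refine ⟨one_sub_inner_ne_zero ℂ ha (mem_ball_zero_iff.1 hz),
    congrArg ((1 - inner ℂ a z)⁻¹ • ·) ?_⟩
  simp only [LinearMap.sub_apply, LinearMap.neg_apply, LinearMap.smul_apply,
    LinearMap.smulRight_apply, innerₛₗ_apply_apply, LinearMap.id_apply]
  module

theorem IsLinearFractionalSelfMap.differentiableOn (hφ : IsLinearFractionalSelfMap φ) :
    DifferentiableOn ℂ φ (unitBall N) := by
  obtain ⟨-, A, B, C, D, h⟩ := hφ
  have hden : Differentiable ℂ fun z : CSpace N => inner ℂ C z + D :=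
    (innerSL ℂ C).differentiable.add_const D
  have hnum : Differentiable ℂ fun z : CSpace N => act A z + B :=
    (act A).differentiable.add_const B
  exact ((hden.differentiableOn.inv fun z hz => (h z hz).1).smul hnum.differentiableOn).congr
    fun z hz => (h z hz).2

theorem IsLinearFractionalSelfMap.exists_normalForm (hφ : IsLinearFractionalSelfMap φ)
    (h₀ : φ 0 = 0) :
    ∃ (A : CSpace N →L[ℂ] CSpace N) (C : CSpace N), ∀ z ∈ unitBall N,
      1 + inner ℂ C z ≠ 0 ∧ φ z = (1 + inner ℂ C z)⁻¹ • A z := by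
  obtain ⟨-, A, B, C, D, h⟩ := hφ
  obtain ⟨hD, hB⟩ := h 0 (mem_ball_self one_pos)
  rw [inner_zero_right, zero_add] at hD
  have hB₀ : B = 0 := by simpa [h₀, hD] using hB.symm
  refine ⟨D⁻¹ • act A, (starRingEnd ℂ D)⁻¹ • C, fun z hz => ?_⟩
  obtain ⟨hden, hφz⟩ := h z hz
  have hfactor : 1 + inner ℂ ((starRingEnd ℂ D)⁻¹ • C) z = D⁻¹ * (inner ℂ C z + D) := by
    rw [inner_smul_left, map_inv₀, Complex.conj_conj, mul_add, inv_mul_cancel₀ hD, add_comm]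
  rw [hfactor]
  refine ⟨mul_ne_zero (inv_ne_zero hD) hden, ?_⟩
  rw [hφz, hB₀, add_zero, _root_.smul_apply, smul_smul, mul_inv, inv_inv, mul_right_comm,
    mul_inv_cancel₀ hD, one_mul]

end LinearFractional

section Conjugation

theorem ker_pow_conj {R M M' : Type*} [CommRing R] [AddCommGroup M] [AddCommGroup M'] [Module R M]
    [Module R M'] (e : M ≃ₗ[R] M') (f : Module.End R M) (n : ℕ) :
    LinearMap.ker (e.conj f ^ n) = (LinearMap.ker (f ^ n)).map (e : M →ₗ[R] M') := by
  have hpow : e.conj f ^ n = e.conj (f ^ n) := (map_pow e.conjRingEquiv f n).symm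
  ext x
  simp [hpow, Submodule.mem_map_equiv]

variable {N : ℕ} {D U W : Set (CSpace N)} {φ χ σ τ σ' τ' : CSpace N → CSpace N} {z w : CSpace N}

theorem unitaryIndex_eq_of_fderiv_eq_conj (e : CSpace N ≃ₗ[ℂ] CSpace N)
    (h : (fderiv ℂ χ w : CSpace N →ₗ[ℂ] CSpace N) = e.conj (fderiv ℂ φ z)) :
    unitaryIndex χ w = unitaryIndex φ z := by
  have hspace : unitarySpace χ w = (unitarySpace φ z).map (e : CSpace N →ₗ[ℂ] CSpace N) := by
    simp only [unitarySpace, Submodule.map_iSup, ← ker_pow_conj, map_sub, map_smul,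
      LinearEquiv.conj_id, h]
  rw [unitaryIndex, unitaryIndex, hspace]
  exact LinearEquiv.finrank_map_eq e _

namespace IsBiholomorphism

theorem trans (h : IsBiholomorphism D U σ τ) (h' : IsBiholomorphism U W σ' τ') :
    IsBiholomorphism D W (σ' ∘ σ) (τ ∘ τ') where
  mapsTo := h'.mapsTo.comp h.mapsTo
  mapsTo_inv := h.mapsTo_inv.comp h'.mapsTo_inv
  leftInv z hz := by simp only [Function.comp_apply, h'.leftInv _ (h.mapsTo hz), h.leftInv z hz]
  rightInv w hw := by
    simp only [Function.comp_apply, h.rightInv _ (h'.mapsTo_inv hw), h'.rightInv w hw]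
  holomorphic := h'.holomorphic.comp h.holomorphic h.mapsTo
  holomorphic_inv := h.holomorphic_inv.comp h'.holomorphic_inv h'.mapsTo_inv

theorem exists_hasFDerivAt_equiv (h : IsBiholomorphism D U σ τ) (hD : IsOpen D) (hU : IsOpen U)
    (hz : z ∈ D) : ∃ e : CSpace N ≃L[ℂ] CSpace N,
      HasFDerivAt σ (e : CSpace N →L[ℂ] CSpace N) z ∧
        HasFDerivAt τ (e.symm : CSpace N →L[ℂ] CSpace N) (σ z) := by
  have hw : σ z ∈ U := h.mapsTo hz
  have hσ := (h.holomorphic.differentiableAt (hD.mem_nhds hz)).hasFDerivAt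
  have hτ := (h.holomorphic_inv.differentiableAt (hU.mem_nhds hw)).hasFDerivAt
  have hτσ : (fderiv ℂ τ (σ z)).comp (fderiv ℂ σ z) = ContinuousLinearMap.id ℂ _ :=
    (hτ.comp z hσ).unique ((hasFDerivAt_id z).congr_of_eventuallyEq
      (Filter.eventually_of_mem (hD.mem_nhds hz) h.leftInv))
  have hστ : (fderiv ℂ σ z).comp (fderiv ℂ τ (σ z)) = ContinuousLinearMap.id ℂ _ := by
    rw [← h.leftInv z hz] at hσ
    have := (hσ.comp (σ z) hτ).unique ((hasFDerivAt_id (σ z)).congr_of_eventuallyEq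
      (Filter.eventually_of_mem (hU.mem_nhds hw) h.rightInv))
    rwa [h.leftInv z hz] at this
  exact ⟨.equivOfInverse _ _ (DFunLike.congr_fun hτσ) (DFunLike.congr_fun hστ), hσ, hτ⟩

theorem unitaryIndex_conj (h : IsBiholomorphism D U σ τ) (hD : IsOpen D) (hU : IsOpen U)
    (hz : z ∈ D) (hφ : DifferentiableAt ℂ φ z) (hfix : φ z = z) :
    unitaryIndex (σ ∘ φ ∘ τ) (σ z) = unitaryIndex φ z := by
  obtain ⟨e, hσ, hτ⟩ := h.exists_hasFDerivAt_equiv hD hU hz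
  refine unitaryIndex_eq_of_fderiv_eq_conj e.toLinearEquiv ?_
  have hφτ : HasFDerivAt (φ ∘ τ) ((fderiv ℂ φ z).comp (e.symm : CSpace N →L[ℂ] CSpace N)) (σ z) :=
    HasFDerivAt.comp _ (by rw [h.leftInv z hz]; exact hφ.hasFDerivAt) hτ
  have hχ : HasFDerivAt (σ ∘ φ ∘ τ) _ (σ z) :=
    HasFDerivAt.comp _ (by rw [Function.comp_apply, h.leftInv z hz, hfix]; exact hσ) hφτ
  rw [hχ.fderiv]
  rfl

end IsBiholomorphism

theorem isBiholomorphism_linearIsometryEquiv (L : CSpace N ≃ₗᵢ[ℂ] CSpace N) :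
    IsBiholomorphism (unitBall N) (unitBall N) L L.symm where
  mapsTo z hz := by simpa using hz
  mapsTo_inv w hw := by simpa using hw
  leftInv z _ := L.symm_apply_apply z
  rightInv w _ := L.apply_symm_apply w
  holomorphic := L.differentiable.differentiableOn
  holomorphic_inv := L.symm.differentiable.differentiableOn

theorem IsConjugate.trans {ψ : CSpace N → CSpace N} (h : IsConjugate D U φ χ)
    (h' : IsConjugate U W χ ψ) : IsConjugate D W φ ψ := by
  obtain ⟨σ, τ, hστ, hχ⟩ := h
  obtain ⟨σ', τ', hστ', hψ⟩ := h'
  exact ⟨σ' ∘ σ, τ ∘ τ', hστ.trans hστ', fun w hw => by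
    rw [hψ w hw, hχ _ (hστ'.mapsTo_inv hw), Function.comp_apply, Function.comp_apply]⟩

theorem isConjugate_linearIsometryEquiv_conj (L : CSpace N ≃ₗᵢ[ℂ] CSpace N)
    (A : Module.End ℂ (CSpace N)) :
    IsConjugate (unitBall N) (unitBall N) A (L.toLinearEquiv.conj A) :=
  ⟨L, L.symm, isBiholomorphism_linearIsometryEquiv L, fun _ _ => rfl⟩

end Conjugation

section FixedOrigin

variable {N : ℕ} {φ : CSpace N → CSpace N} {z₀ : CSpace N}

theorem unitarySpace_eq_unimodularSpace (hφ : ‖fderiv ℂ φ z₀‖ ≤ 1) :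
    unitarySpace φ z₀ = unimodularSpace (fderiv ℂ φ z₀ : CSpace N →ₗ[ℂ] CSpace N) := by
  rcases eq_or_ne N 0 with rfl | hN
  · exact Subsingleton.elim _ _
  · exact iSup_congr fun μ => iSup_congr fun hμ => ker_sub_smul_pow_eq_eigenspace hφ hμ hN

theorem hasFDerivAt_zero_inv_smul {𝕜 E F : Type*} [NontriviallyNormedField 𝕜]
    [NormedAddCommGroup E] [NormedSpace 𝕜 E] [NormedAddCommGroup F] [NormedSpace 𝕜 F]
    (A : E →L[𝕜] F) (ℓ : E →L[𝕜] 𝕜) :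
    HasFDerivAt (fun z => (1 + ℓ z)⁻¹ • A z) A 0 := by
  have hinv : DifferentiableAt 𝕜 (fun z => (1 + ℓ z)⁻¹) 0 :=
    (ℓ.differentiableAt.const_add 1).inv (by simp)
  convert hinv.hasFDerivAt.fun_smul A.hasFDerivAt using 1
  ext x
  simp

theorem IsLinearFractionalSelfMap.eqOn_fderiv (hφ : IsLinearFractionalSelfMap φ) (h₀ : φ 0 = 0)
    (hu : unitarySpace φ 0 ≠ ⊥) :
    ‖fderiv ℂ φ 0‖ ≤ 1 ∧ EqOn φ (fderiv ℂ φ 0) (unitBall N) := by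
  obtain ⟨A, C, h⟩ := hφ.exists_normalForm h₀
  have hderiv : fderiv ℂ φ 0 = A :=
    ((hasFDerivAt_zero_inv_smul A (innerSL ℂ C)).congr_of_eventuallyEq
      (Filter.eventually_of_mem (ball_mem_nhds 0 one_pos) fun z hz => (h z hz).2)).fderiv
  have hschwarz : ∀ w, ‖A w‖ + ‖inner ℂ C w‖ ≤ ‖w‖ := by
    refine norm_apply_add_norm_apply_le (A := (A : CSpace N →ₗ[ℂ] CSpace N)) (ℓ := innerₛₗ ℂ C)
      (fun z hz => (h z hz).1) fun z hz => ?_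
    have hlt : ‖φ z‖ < 1 := mem_ball_zero_iff.1 (hφ.1 hz)
    rw [(h z hz).2, norm_smul, norm_inv, inv_mul_lt_iff₀ (norm_pos_iff.2 (h z hz).1),
      mul_one] at hlt
    exact hlt.le
  have hA : ‖A‖ ≤ 1 := A.opNorm_le_bound zero_le_one fun w => by
    linarith [hschwarz w, norm_nonneg (inner ℂ C w)]
  rw [hderiv]
  refine ⟨hA, fun z hz => ?_⟩
  rw [unitarySpace_eq_unimodularSpace (hderiv ▸ hA), hderiv] at hu
  obtain ⟨μ, hμ, heig⟩ := exists_hasEigenvalue_of_unimodularSpace_ne_bot hu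
  have hC : C = 0 := eq_zero_of_norm_apply_add_norm_inner_le hschwarz hμ heig
  rw [(h z hz).2, hC, inner_zero_left, add_zero, inv_one, one_smul]

theorem IsLinearFractionalSelfMap.exists_isConjugate_contraction
    (hφ : IsLinearFractionalSelfMap φ) (hz₀ : z₀ ∈ unitBall N) (hfix : φ z₀ = z₀)
    (hu : 1 ≤ unitaryIndex φ z₀) :
    ∃ A : CSpace N →L[ℂ] CSpace N, ‖A‖ ≤ 1 ∧ IsConjugate (unitBall N) (unitBall N) φ A ∧
      Module.finrank ℂ (unimodularSpace (A : CSpace N →ₗ[ℂ] CSpace N)) = unitaryIndex φ z₀ := by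
  have hz₀_norm : ‖z₀‖ < 1 := mem_ball_zero_iff.1 hz₀
  set σ := ballInvolution ℂ z₀
  have hσ₀ : σ 0 = z₀ := ballInvolution_zero ℂ z₀
  have hσz₀ : σ z₀ = 0 := ballInvolution_self ℂ hz₀_norm
  have hσ : IsBiholomorphism (unitBall N) (unitBall N) σ σ :=
    isBiholomorphism_ballInvolution hz₀_norm
  have hσ_lf : IsLinearFractionalSelfMap σ := isLinearFractionalSelfMap_ballInvolution hz₀_norm
  have hχ : IsLinearFractionalSelfMap (σ ∘ φ ∘ σ) := hσ_lf.comp (hφ.comp hσ_lf)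
  have hχ₀ : (σ ∘ φ ∘ σ) 0 = 0 := by
    rw [Function.comp_apply, Function.comp_apply, hσ₀, hfix, hσz₀]
  have hindex : unitaryIndex (σ ∘ φ ∘ σ) 0 = unitaryIndex φ z₀ :=
    hσz₀ ▸ hσ.unitaryIndex_conj isOpen_ball isOpen_ball hz₀
      (hφ.differentiableOn.differentiableAt (isOpen_ball.mem_nhds hz₀)) hfix
  have hspace : unitarySpace (σ ∘ φ ∘ σ) 0 ≠ ⊥ := fun h => by
    rw [unitaryIndex, h, finrank_bot] at hindex
    omega
  obtain ⟨hA, hχA⟩ := hχ.eqOn_fderiv hχ₀ hspace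
  refine ⟨fderiv ℂ (σ ∘ φ ∘ σ) 0, hA, ⟨σ, σ, hσ, fun w hw => (hχA hw).symm⟩, ?_⟩
  rw [← unitarySpace_eq_unimodularSpace hA, ← hindex, unitaryIndex]

end FixedOrigin

end LFT

theorem mainTheorem11 {N : ℕ} (φ : LFT.CSpace N → LFT.CSpace N)
    (hφ : LFT.IsLinearFractionalSelfMap φ)
    (z₀ : LFT.CSpace N) (hz₀ : z₀ ∈ LFT.unitBall N) (hfix : φ z₀ = z₀)
    (hu : 1 ≤ LFT.unitaryIndex φ z₀) :
    ∃ (ψ : LFT.CSpace N → LFT.CSpace N)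
      (Λ : Matrix (Fin (LFT.unitaryIndex φ z₀)) (Fin (LFT.unitaryIndex φ z₀)) ℂ)
      (A₁ : Matrix (Fin (N - LFT.unitaryIndex φ z₀)) (Fin (N - LFT.unitaryIndex φ z₀)) ℂ),
      LFT.IsLinearFractionalSelfMap ψ ∧
      LFT.IsConjugate (LFT.unitBall N) (LFT.unitBall N) φ ψ ∧
      Λ.IsDiag ∧ Λ ∈ Matrix.unitaryGroup (Fin (LFT.unitaryIndex φ z₀)) ℂ ∧
      spectralRadius ℂ A₁ < 1 ∧ ‖LFT.act A₁‖ ≤ 1 ∧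
      ∀ (z' : LFT.CSpace (LFT.unitaryIndex φ z₀))
        (z'' : LFT.CSpace (N - LFT.unitaryIndex φ z₀)),
        LFT.pair (LFT.unitaryIndex_le φ z₀) z' z'' ∈ LFT.unitBall N →
        ψ (LFT.pair (LFT.unitaryIndex_le φ z₀) z' z'') =
          LFT.pair (LFT.unitaryIndex_le φ z₀) (LFT.act Λ z') (LFT.act A₁ z'') := by
  obtain ⟨A, hA, hconj, hindex⟩ := hφ.exists_isConjugate_contraction hz₀ hfix hu
  obtain ⟨U, Λ, A₁, hdiag, hunit, hrad, hle, hblock⟩ :=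
    LFT.exists_isometry_blockForm (LFT.unitaryIndex_le φ z₀) finrank_euclideanSpace_fin hA hindex
  have hψ_norm : ∀ w, ‖U.toLinearEquiv.conj (A : LFT.CSpace N →ₗ[ℂ] LFT.CSpace N) w‖ ≤ ‖w‖ := by
    intro w
    calc ‖U (A (U.symm w))‖ = ‖A (U.symm w)‖ := U.norm_map _
      _ ≤ 1 * ‖U.symm w‖ := A.le_of_opNorm_le hA _
      _ = ‖w‖ := by rw [one_mul, U.symm.norm_map]
  exact ⟨_, Λ, A₁, LFT.isLinearFractionalSelfMap_of_norm_apply_le hψ_norm,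
    hconj.trans (LFT.isConjugate_linearIsometryEquiv_conj U _), hdiag, hunit, hrad, hle,
    fun z' z'' _ => hblock z' z''⟩
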